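/- Let $N=\{1,\dots,n\}$ be a set of players and let $A$ be a finite nonempty set of alternatives with payoff function $v:A\to\mathbb{R}^n$. A coalition is a nonempty subset of $N$. For each coalition $C$ let $E_C:A\rightrightarrows A$ be a correspondence with $a\in E_C(a)$ for all $a\in A$; $E_C(a)$ is the set of alternatives to which $C$ can move by blocking the recommendation $a$. The stage game is repeated at $t=0,1,2,\dots$ with common discount factor $\delta\in[0,1)$. An outcome is a pair $(a,C)$ with $a\in A$ and $C\subseteq N$, where $C$ is the blocking coalition and $C=\emptyset$ means that the recommendation was not blocked. A history is a finite (possibly empty) sequence of outcomes. A convention is a map $\sigma$ that assigns to every history $h$ an unblocked outcome $\sigma(h)=(a(h|\sigma),\emptyset)$. Let $a^0,a^1,\dots$ be the alternatives chosen when $\sigma$ is followed in every period after $h$, and let $U_i(h|\sigma)=(1-\delta)\sum_{t=0}^\infty\delta^t v_i(a^t)$. The convention $\sigma$ is stable (for $\delta$) if there are no history $h$, coalition $C$ and $a'\in E_C(a(h|\sigma))$ such that $$(1-\delta)v_i(a')+\delta\,U_i\big((h,(a',C))\,\big|\,\sigma\big)>U_i(h|\sigma)\qquad\text{for every } i\in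 C .$$ Let $\underline v_i=\min_{a\in A}\max_{a'\in E_{\{i\}}(a)}v_i(a')$ be player $i$'s pure minmax, and let $\mathcal V_{IR}$ be the set of $u\in\operatorname{conv}\{v(a):a\in A\}$ with $u_i>\underline v_i$ for every $i\in N$. The stage game has nonequivalent utilities if there are no two distinct players $i,j$ and constants $k\in\mathbb{R}$, $\lambda>0$ with $v_i(a)=k+\lambda v_j(a)$ for all $a\in A$. Theorem. (1) For every $\delta\in[0,1)$, every stable convention $\sigma$ satisfies $U_i(\emptyset|\sigma)\ge\underline v_i$ for every player $i$. (2) If the stage game has nonequivalent utilities, then for every $u\in\mathcal V_{IR}$ there is $\underline\delta\in[0,1)$ such that for every $\delta\in(\underline\delta,1)$ there exists a stable convention $\sigma$ with $U_i(\emptyset|\sigma)=u_i$ for every player $i$. -/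

import Mathlib

/-- A non-transferable utility stage game with players `Fin n` and set of alternatives `A`.
`payoff a i` is player `i`'s payoff from `a`, and `eff C a` is the set of alternatives to which
coalition `C` can move by blocking the recommendation `a`. Coalitions are the nonempty sets of
players; the value of `eff` at the empty set plays no role. -/
structure StageGame (n : ℕ) (A : Type*) where
  payoff : A → Fin n → ℝ
  eff : Finset (Fin n) → A → Finset A
  eff_refl : ∀ C : Finset (Fin n), C.Nonempty → ∀ a : A, a ∈ eff C a

/-- Outcomes: the chosen alternative and the blocking coalition, where the empty set means that
the recommendation was not blocked. -/
abbrev Outcome (n : ℕ) (A : Type*) := A × Finset (Fin n)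

/-- Histories: finite sequences of outcomes in chronological order. -/
abbrev History (n : ℕ) (A : Type*) := List (Outcome n A)

/-- A plan recommends an outcome after every history. -/
abbrev Plan (n : ℕ) (A : Type*) := History n A → Outcome n A

namespace Plan

variable {n : ℕ} {A : Type*}

/-- A convention recommends only unblocked outcomes. -/
def IsConvention (σ : Plan n A) : Prop :=
  ∀ h : History n A, (σ h).2 = ∅

/-- The history reached when, starting from `h`, the plan is followed for `t` periods. -/
def historyAfter (σ : Plan n A) (h : History n A) : ℕ → History n A
  | 0 => h
  | t + 1 => historyAfter σ h t ++ [σ (historyAfter σ h t)]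

/-- The outcome path generated by the plan after the history `h`. -/
def path (σ : Plan n A) (h : History n A) (t : ℕ) : Outcome n A :=
  σ (σ.historyAfter h t)

end Plan

namespace StageGame

variable {n : ℕ} {A : Type*}

/-- Nonequivalent utilities: no two distinct players have payoff functions that are positive
affine transformations of each other. -/
def NEU (G : StageGame n A) : Prop :=
  ¬ ∃ i j : Fin n, i ≠ j ∧ ∃ k l : ℝ, 0 < l ∧ ∀ a : A, G.payoff a i = k + l * G.payoff a j

/-- The pure minmax payoff of player `i`: the minimum over recommendations `a` of the maximum of
player `i`'s payoff over the alternatives to which she can move on her own. -/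
noncomputable def minmax [Fintype A] [Nonempty A] (G : StageGame n A) (i : Fin n) : ℝ :=
  Finset.univ.inf' Finset.univ_nonempty fun a : A =>
    (G.eff {i} a).sup' ⟨a, G.eff_refl {i} (Finset.singleton_nonempty i) a⟩
      fun a' => G.payoff a' i

/-- Feasible payoff vectors: the convex hull of the payoff vectors of alternatives. -/
def feasible (G : StageGame n A) : Set (Fin n → ℝ) :=
  convexHull ℝ (Set.range G.payoff)

/-- Feasible payoff vectors that are strictly individually rational. -/
def feasibleIR [Fintype A] [Nonempty A] (G : StageGame n A) : Set (Fin n → ℝ) :=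
  {v | v ∈ G.feasible ∧ ∀ i, G.minmax i < v i}

/-- The normalized discounted payoff of player `i` from an outcome path. -/
noncomputable def pathPayoff (G : StageGame n A) (δ : ℝ) (p : ℕ → Outcome n A) (i : Fin n) : ℝ :=
  (1 - δ) * ∑' t : ℕ, δ ^ t * G.payoff (p t).1 i

/-- Player `i`'s payoff from following the plan `σ` after the history `h`. -/
noncomputable def value (G : StageGame n A) (δ : ℝ) (σ : Plan n A) (h : History n A)
    (i : Fin n) : ℝ :=
  G.pathPayoff δ (σ.path h) i

/-- A stable convention: a convention such that after no history some coalition has a feasible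
one-shot deviation that makes all of its members strictly better off. -/
def IsStableConvention (G : StageGame n A) (δ : ℝ) (σ : Plan n A) : Prop :=
  σ.IsConvention ∧
    ∀ h : History n A, ¬ ∃ C : Finset (Fin n), C.Nonempty ∧ ∃ a' ∈ G.eff C (σ h).1,
      ∀ i ∈ C, G.value δ σ h i < (1 - δ) * G.payoff a' i + δ * G.value δ σ (h ++ [(a', C)]) i

end StageGame

/-! (1) Whatever is recommended, player `i` can move alone to an alternative worth at least her
minmax. Stability makes this unprofitable, so any shortfall of her value below the minmax is at most
`δ` times a later shortfall. Bounded payoffs then force it to be zero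
(`minmax_le_value_of_isStableConvention`).

(2) A blocking coalition is observed and all of its members must gain, so it is enough to deter one
of them. That scapegoat is minmaxed for `T` periods, and play then moves to a path that is worse for
her than the target and than every other player's punishment path. Only a coalition consisting
solely of the player being punished needs a separate argument. Nonequivalent utilities supply such
paths as lotteries (`exists_punishment_lotteries`). Patience replaces each lottery by a
deterministic path with exactly its payoff and nearly constant continuation values
(`exists_path_of_lottery`). `exists_isStableConvention_of_punishments` checks the incentives. The
gap `g` and the error constant `K` do not depend on `δ`, so `T` is fixed before `δ` tends to 1. -/

open Finset Filter Topology

namespace StageGame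

/-- The expected payoff vector of a lottery (or, more generally, a signed weighting) `w`. -/
def expectedPayoff {n : ℕ} {A : Type*} [Fintype A] (G : StageGame n A) (w : A → ℝ)
    (i : Fin n) : ℝ :=
  ∑ a, w a * G.payoff a i

variable {n : ℕ} {A : Type*}

/-! ### Discounted sums and payoff bounds. -/

/-- A bounded solution of the dynamic-programming recursion is the discounted sum. -/
theorem discountedSum_eq_of_recursion {δ B : ℝ} (h0 : 0 ≤ δ) (h1 : δ < 1) {f W : ℕ → ℝ}
    (hf : ∀ t, |f t| ≤ B) (hW : ∀ t, |W t| ≤ B)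
    (hrec : ∀ t, W t = (1 - δ) * f t + δ * W (t + 1)) :
    (1 - δ) * ∑' t, δ ^ t * f t = W 0 := by
  have hpart : ∀ N, (1 - δ) * ∑ t ∈ range N, δ ^ t * f t = W 0 - δ ^ N * W N := by
    intro N
    induction N with
    | zero => simp
    | succ N ih =>
      rw [sum_range_succ, mul_add, ih, pow_succ]
      linear_combination (-δ ^ N) * hrec N
  have hs : Summable fun t => δ ^ t * f t := by
    refine Summable.of_norm_bounded ((summable_geometric_of_lt_one h0 h1).mul_right B) fun t => ?_
    rw [norm_mul, norm_pow, Real.norm_of_nonneg h0]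
    exact mul_le_mul_of_nonneg_left (hf t) (pow_nonneg h0 t)
  have hz : Tendsto (fun N => δ ^ N * W N) atTop (𝓝 0) := by
    refine squeeze_zero_norm (a := fun N => δ ^ N * B) (fun N => ?_) ?_
    · rw [norm_mul, norm_pow, Real.norm_of_nonneg h0]
      exact mul_le_mul_of_nonneg_left (hW N) (pow_nonneg h0 N)
    · simpa using (tendsto_pow_atTop_nhds_zero_of_lt_one h0 h1).mul_const B
  refine tendsto_nhds_unique (hs.hasSum.tendsto_sum_nat.const_mul (1 - δ)) ?_
  simp_rw [hpart]
  simpa using tendsto_const_nhds.sub hz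

theorem abs_discountedSum_le {δ B : ℝ} (h0 : 0 ≤ δ) (h1 : δ < 1) {f : ℕ → ℝ}
    (hf : ∀ t, |f t| ≤ B) : |(1 - δ) * ∑' t, δ ^ t * f t| ≤ B := by
  have h : ‖∑' t, δ ^ t * f t‖ ≤ (1 - δ)⁻¹ * B := by
    refine tsum_of_norm_bounded ((hasSum_geometric_of_lt_one h0 h1).mul_right B) fun t => ?_
    rw [norm_mul, norm_pow, Real.norm_of_nonneg h0]
    exact mul_le_mul_of_nonneg_left (hf t) (pow_nonneg h0 t)
  rw [abs_mul, abs_of_pos (sub_pos.2 h1)]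
  calc (1 - δ) * |∑' t, δ ^ t * f t| ≤ (1 - δ) * ((1 - δ)⁻¹ * B) :=
        mul_le_mul_of_nonneg_left h (sub_pos.2 h1).le
    _ = B := by rw [mul_inv_cancel_left₀ (sub_pos.2 h1).ne']

theorem exists_abs_payoff_le [Finite A] (G : StageGame n A) :
    ∃ M : ℝ, 0 ≤ M ∧ ∀ a i, |G.payoff a i| ≤ M := by
  cases nonempty_fintype A
  refine ⟨∑ a, ∑ i, |G.payoff a i|, by positivity, fun a i => ?_⟩
  calc |G.payoff a i| ≤ ∑ i, |G.payoff a i| :=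
        single_le_sum (f := fun i => |G.payoff a i|) (fun _ _ => abs_nonneg _) (mem_univ i)
    _ ≤ _ := single_le_sum (f := fun a => ∑ i, |G.payoff a i|)
        (fun _ _ => sum_nonneg fun _ _ => abs_nonneg _) (mem_univ a)

/-! ### The minmax lower bound. -/

section MinMax

variable [Fintype A] [Nonempty A] (G : StageGame n A)

theorem exists_minmax_le_of_recommendation (i : Fin n) (a : A) :
    ∃ a' ∈ G.eff {i} a, G.minmax i ≤ G.payoff a' i := by
  obtain ⟨a', ha', h⟩ := exists_mem_eq_sup' (s := G.eff {i} a)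
    ⟨a, G.eff_refl {i} (singleton_nonempty i) a⟩ (fun a' => G.payoff a' i)
  exact ⟨a', ha', h ▸ inf'_le _ (mem_univ a)⟩

theorem exists_minmax_recommendation (i : Fin n) :
    ∃ a : A, ∀ a' ∈ G.eff {i} a, G.payoff a' i ≤ G.minmax i := by
  obtain ⟨a, -, h⟩ := exists_mem_eq_inf' (univ_nonempty (α := A)) (fun a : A =>
    (G.eff {i} a).sup' ⟨a, G.eff_refl {i} (singleton_nonempty i) a⟩
      fun a' => G.payoff a' i)
  refine ⟨a, fun a' ha' => ?_⟩
  rw [minmax, h]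
  exact le_sup' (fun a' => G.payoff a' i) ha'

theorem minmax_le_value_of_isStableConvention {δ : ℝ} (h0 : 0 ≤ δ) (h1 : δ < 1) {σ : Plan n A}
    (hσ : G.IsStableConvention δ σ) (h : History n A) (i : Fin n) :
    G.minmax i ≤ G.value δ σ h i := by
  obtain ⟨M, -, hM⟩ := G.exists_abs_payoff_le
  have hstep : ∀ h, ∃ h', (1 - δ) * G.minmax i + δ * G.value δ σ h' i ≤ G.value δ σ h i := by
    intro h
    obtain ⟨a', ha', hle⟩ := G.exists_minmax_le_of_recommendation i (σ h).1
    refine ⟨h ++ [(a', {i})], ?_⟩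
    by_contra! hlt
    refine hσ.2 h ⟨{i}, singleton_nonempty i, a', ha', fun j hj => ?_⟩
    obtain rfl := mem_singleton.1 hj
    have := mul_le_mul_of_nonneg_left hle (sub_pos.2 h1).le
    linarith
  -- Each deviation leads to a new, off-path history, so the induction must range over all `h`.
  have hit : ∀ (t : ℕ) h, -(δ ^ t * (M + G.minmax i)) ≤ G.value δ σ h i - G.minmax i := by
    intro t
    induction t with
    | zero =>
      intro h
      have : |G.value δ σ h i| ≤ M := abs_discountedSum_le h0 h1 fun t => hM _ i
      linarith [neg_le_of_abs_le this]
    | succ t ih =>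
      intro h
      obtain ⟨h', hh⟩ := hstep h
      have := mul_le_mul_of_nonneg_left (ih h') h0
      rw [pow_succ]
      linarith
  have hlim : Tendsto (fun t : ℕ => -(δ ^ t * (M + G.minmax i))) atTop (𝓝 0) := by
    simpa using ((tendsto_pow_atTop_nhds_zero_of_lt_one h0 h1).mul_const (M + G.minmax i)).neg
  linarith [le_of_tendsto' hlim fun t => hit t h]

end MinMax

/-! ### Conventions generated by automata. -/

/-- Description of a convention by an automaton with state space `S`:
the bounded solution `W` of its value recursion gives the payoffs of the induced convention. -/
theorem exists_isStableConvention_of_automaton (G : StageGame n A) {δ B : ℝ} (h0 : 0 ≤ δ)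
    (h1 : δ < 1) {S : Type*} (s₀ : S) (rec : S → A) (next : S → Outcome n A → S)
    (W : S → Fin n → ℝ) (hB : ∀ a i, |G.payoff a i| ≤ B) (hW : ∀ s i, |W s i| ≤ B)
    (hrec : ∀ s i, W s i = (1 - δ) * G.payoff (rec s) i + δ * W (next s (rec s, ∅)) i)
    (hstable : ∀ s, ∀ C : Finset (Fin n), C.Nonempty → ∀ a' ∈ G.eff C (rec s),
      ∃ i ∈ C, (1 - δ) * G.payoff a' i + δ * W (next s (a', C)) i ≤ W s i) :
    ∃ σ : Plan n A, G.IsStableConvention δ σ ∧ ∀ i, G.value δ σ [] i = W s₀ i := by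
  let st : History n A → S := fun h => h.foldl next s₀
  have hst : ∀ h o, st (h ++ [o]) = next (st h) o := fun h o => by simp [st]
  let σ : Plan n A := fun h => (rec (st h), ∅)
  have hval : ∀ h i, G.value δ σ h i = W (st h) i := by
    intro h i
    refine discountedSum_eq_of_recursion (B := B) h0 h1
      (W := fun t => W (st (σ.historyAfter h t)) i) (fun t => hB _ i) (fun t => hW _ i) fun t => ?_
    have : st (σ.historyAfter h (t + 1)) = next (st (σ.historyAfter h t))
        (rec (st (σ.historyAfter h t)), ∅) := hst _ _
    rw [this]
    exact hrec _ i
  refine ⟨σ, ⟨fun _ => rfl, ?_⟩, fun i => hval [] i⟩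
  rintro h ⟨C, hC, a', ha', hlt⟩
  obtain ⟨i, hi, hle⟩ := hstable (st h) C hC a' ha'
  have := hlt i hi
  rw [hval, hval, hst] at this
  exact this.not_ge hle

/-! ### Deterministic paths that replicate a lottery. -/

section Lottery

variable [Fintype A]

/-- Exact implementation of a lottery by a deterministic path: for patient players, the discounted
payoff is that of the lottery, and all continuation payoffs are within `O(1 - δ)` of it. -/
theorem exists_path_of_lottery (G : StageGame n A) {w : A → ℝ} (hw : w ∈ stdSimplex ℝ A) :
    ∃ K : ℝ, 0 ≤ K ∧ ∀ᶠ δ in 𝓝[<] (1 : ℝ), ∃ (q : ℕ → A) (X : ℕ → Fin n → ℝ),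
      X 0 = G.expectedPayoff w ∧
      (∀ t i, X t i = (1 - δ) * G.payoff (q t) i + δ * X (t + 1) i) ∧
      ∀ t i, |X t i - G.expectedPayoff w i| ≤ K * (1 - δ) := by
  classical
  obtain ⟨M, hM0, hM⟩ := G.exists_abs_payoff_le
  obtain ⟨hw0, hw1⟩ := hw
  set m : ℝ := (Fintype.card A : ℝ) with hm
  have hm0 : 0 ≤ m := Nat.cast_nonneg _
  refine ⟨2 * (m * ((m + 1) * M)), by positivity, ?_⟩
  have hlim : Tendsto (fun δ : ℝ => δ⁻¹ - 1) (𝓝[<] 1) (𝓝 0) := by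
    have : Tendsto (fun δ : ℝ => δ⁻¹ - 1) (𝓝 1) (𝓝 (1⁻¹ - 1)) :=
      (tendsto_inv₀ one_ne_zero).sub_const 1
    simpa using this.mono_left nhdsWithin_le_nhds
  -- With this much patience, a debt `-1` scaled by `δ⁻¹` and credited with `w a` is again at least
  -- `-1`.
  have hsmall : ∀ᶠ δ in 𝓝[<] (1 : ℝ), ∀ a, 0 < w a → δ⁻¹ - 1 ≤ w a := by
    refine eventually_all.2 fun a => ?_
    by_cases ha : 0 < w a
    · filter_upwards [hlim.eventually (eventually_le_nhds ha)] with δ hδ _ using hδ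
    · exact Eventually.of_forall fun _ h => absurd h ha
  have hhalf : ∀ᶠ δ in 𝓝[<] (1 : ℝ), 1 / 2 < δ :=
    eventually_nhdsWithin_of_eventually_nhds (eventually_gt_nhds (by norm_num))
  filter_upwards [hsmall, hhalf, self_mem_nhdsWithin] with δ hη hδ hδ1
  have hδ1 : δ < 1 := hδ1
  have hδ0 : 0 < δ := by linarith
  have hinv : 1 ≤ δ⁻¹ := (one_le_inv₀ hδ0).2 hδ1.le
  -- `x a` is the account of plays still owed to `a`: each period it grows by the factor `δ⁻¹`, is
  -- credited `w a`, and is debited 1 if `a` is played. Playing only supported alternatives with a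
  -- nonnegative account preserves `P`.
  let P : (A → ℝ) → Prop := fun x => ∑ a, x a = 0 ∧ ∀ a, -1 ≤ x a ∧ (w a = 0 → x a = 0)
  have hchoose : ∀ x, P x → ∃ a, 0 < w a ∧ 0 ≤ x a := by
    rintro x ⟨hsum, hx⟩
    by_contra! hneg
    have hle : ∀ a ∈ univ, x a ≤ 0 := fun a _ => by
      rcases (hw0 a).lt_or_eq with h | h
      · exact (hneg a h).le
      · exact ((hx a).2 h.symm).le
    have hz := (sum_eq_zero_iff_of_nonpos hle).1 hsum
    have hwz : ∀ a, w a = 0 := fun a => by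
      rcases (hw0 a).lt_or_eq with h | h
      · exact absurd (hz a (mem_univ a)) (hneg a h).ne
      · exact h.symm
    simp [hwz] at hw1
  have hstep : ∀ x : {x // P x}, ∃ (a : A) (y : {x // P x}),
      ∀ b, y.1 b = δ⁻¹ * x.1 b + w b - Pi.single (M := fun _ => ℝ) a 1 b := by
    rintro ⟨x, hx⟩
    obtain ⟨a, hwa, hxa⟩ := hchoose x hx
    refine ⟨a, ⟨fun b => δ⁻¹ * x b + w b - Pi.single (M := fun _ => ℝ) a 1 b, ?_, fun b => ?_⟩,
      fun b => rfl⟩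
    · rw [sum_sub_distrib, sum_add_distrib, ← mul_sum, hx.1, hw1]
      simp
    · by_cases hb : b = a
      · subst hb
        have : 0 ≤ δ⁻¹ * x b := by positivity
        simp only [Pi.single_eq_same]
        exact ⟨by linarith, fun h => absurd h hwa.ne'⟩
      · simp only [Pi.single_eq_of_ne hb, sub_zero]
        refine ⟨?_, fun h => by rw [h, (hx.2 b).2 h]; simp⟩
        rcases (hw0 b).lt_or_eq with h | h
        · have := hη b h
          nlinarith [(hx.2 b).1]
        · rw [← h, (hx.2 b).2 h.symm]; norm_num
  choose act nxt hnxt using hstep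
  let x : ℕ → {x // P x} := fun t => nxt^[t] ⟨0, by simp [P]⟩
  have hx : ∀ t, x (t + 1) = nxt (x t) := fun t => Function.iterate_succ_apply' _ _ _
  -- Entries that are at least `-1` and sum to zero are bounded by a constant independent of `δ`;
  -- this makes `K` uniform.
  have hxabs : ∀ t a, |(x t).1 a| ≤ m + 1 := by
    intro t a
    obtain ⟨hsum, hb⟩ := (x t).2
    have h2 : (x t).1 a + 1 ≤ ∑ b, ((x t).1 b + 1) :=
      single_le_sum (f := fun b => (x t).1 b + 1) (fun b _ => by linarith [(hb b).1]) (mem_univ a)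
    rw [sum_add_distrib, hsum] at h2
    simp only [sum_const, card_univ, nsmul_eq_mul, mul_one] at h2
    rw [abs_le]
    constructor <;> linarith [(hb a).1]
  refine ⟨fun t => act (x t),
    fun t i => G.expectedPayoff w i + (δ⁻¹ - 1) * G.expectedPayoff (x t).1 i, ?_, ?_, ?_⟩
  · ext i
    simp [x, expectedPayoff]
  · intro t i
    have : G.expectedPayoff (x (t + 1)).1 i = δ⁻¹ * G.expectedPayoff (x t).1 i
        + G.expectedPayoff w i - G.payoff (act (x t)) i := by
      simp only [expectedPayoff, hx, hnxt, sub_mul, add_mul, sum_sub_distrib, sum_add_distrib,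
        mul_sum, mul_assoc]
      simp [Pi.single_apply]
    simp only [this]
    field_simp
    ring
  · intro t i
    have hsum : |G.expectedPayoff (x t).1 i| ≤ m * ((m + 1) * M) := by
      refine (abs_sum_le_sum_abs _ _).trans ?_
      calc ∑ a, |(x t).1 a * G.payoff a i| ≤ ∑ _a : A, (m + 1) * M := by
            refine sum_le_sum fun a _ => ?_
            rw [abs_mul]
            exact mul_le_mul (hxabs t a) (hM a i) (abs_nonneg _) (by positivity)
        _ = _ := by simp [hm]
    have hη2 : δ⁻¹ - 1 ≤ 2 * (1 - δ) := by
      have : δ⁻¹ ≤ 2 := by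
        rw [inv_le_comm₀ hδ0 two_pos]; linarith
      have h3 : δ⁻¹ - 1 = δ⁻¹ * (1 - δ) := by field_simp
      rw [h3]
      exact mul_le_mul_of_nonneg_right this (by linarith)
    rw [add_sub_cancel_left, abs_mul, abs_of_nonneg (sub_nonneg.2 hinv)]
    calc (δ⁻¹ - 1) * |G.expectedPayoff (x t).1 i| ≤ (2 * (1 - δ)) * (m * ((m + 1) * M)) :=
          mul_le_mul hη2 hsum (abs_nonneg _) (by linarith)
      _ = _ := by ring

end Lottery

end StageGame
namespace StageGame

variable {n : ℕ} {A : Type*}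

/-! ### Lotteries for player-specific punishments. -/

section Lottery

variable [Fintype A]

theorem expectedPayoff_convexCombination (G : StageGame n A) (w w' : A → ℝ) (c d : ℝ) (i : Fin n) :
    G.expectedPayoff (c • w + d • w') i = c * G.expectedPayoff w i + d * G.expectedPayoff w' i := by
  simp only [expectedPayoff, mul_sum, ← sum_add_distrib, Pi.add_apply, Pi.smul_apply, smul_eq_mul]
  exact sum_congr rfl fun a _ => by ring

theorem expectedPayoff_single [DecidableEq A] (G : StageGame n A) (a : A) (i : Fin n) :
    G.expectedPayoff (Pi.single a 1) i = G.payoff a i := by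
  simp [expectedPayoff, Pi.single_apply]

theorem expectedPayoff_le (G : StageGame n A) {w : A → ℝ} (hw : w ∈ stdSimplex ℝ A) {M : ℝ}
    {i : Fin n} (h : ∀ a, G.payoff a i ≤ M) : G.expectedPayoff w i ≤ M :=
  calc G.expectedPayoff w i ≤ ∑ a, w a * M :=
        sum_le_sum fun a _ => mul_le_mul_of_nonneg_left (h a) (hw.1 a)
    _ = M := by rw [← sum_mul, hw.2, one_mul]

theorem le_expectedPayoff (G : StageGame n A) {w : A → ℝ} (hw : w ∈ stdSimplex ℝ A) {M : ℝ}
    {i : Fin n} (h : ∀ a, M ≤ G.payoff a i) : M ≤ G.expectedPayoff w i :=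
  calc M = ∑ a, w a * M := by rw [← sum_mul, hw.2, one_mul]
    _ ≤ _ := sum_le_sum fun a _ => mul_le_mul_of_nonneg_left (h a) (hw.1 a)

theorem exists_lottery_of_mem_feasible (G : StageGame n A) {v : Fin n → ℝ} (hv : v ∈ G.feasible) :
    ∃ w ∈ stdSimplex ℝ A, G.expectedPayoff w = v := by
  classical
  refine convexHull_min (t := {v | ∃ w ∈ stdSimplex ℝ A, G.expectedPayoff w = v}) ?_ ?_ hv
  · rintro _ ⟨a, rfl⟩
    exact ⟨Pi.single a 1, single_mem_stdSimplex ℝ a, funext (G.expectedPayoff_single a)⟩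
  · rintro _ ⟨w, hw, rfl⟩ _ ⟨w', hw', rfl⟩ c d hc hd hcd
    exact ⟨c • w + d • w', convex_stdSimplex ℝ A hw hw' hc hd hcd,
      funext (G.expectedPayoff_convexCombination w w' c d)⟩

/-- Nonequivalent, nonconstant utilities can be separated: there are lotteries, one per player,
such that every player strictly prefers the lotteries of the others to her own. -/
theorem exists_separating_lotteries [Nonempty A] (G : StageGame n A) (hG : G.NEU)
    (hne : ∀ i, ∃ a b, G.payoff a i ≠ G.payoff b i) :
    ∃ r : Fin n → A → ℝ, (∀ i, r i ∈ stdSimplex ℝ A) ∧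
      ∀ i j, i ≠ j → G.expectedPayoff (r i) i < G.expectedPayoff (r j) i := by
  set m : ℝ := (Fintype.card A : ℝ) with hm
  have hm0 : 0 < m := Nat.cast_pos.2 Fintype.card_pos
  let avg : Fin n → ℝ := fun i => (∑ a, G.payoff a i) / m
  let c : Fin n → EuclideanSpace ℝ A := fun i => WithLp.toLp 2 fun a => G.payoff a i - avg i
  have hcsum : ∀ i, ∑ a, c i a = 0 := fun i => by
    simp only [c, avg, sum_sub_distrib, sum_const, card_univ, nsmul_eq_mul, ← hm]
    field_simp
    ring
  have hc : ∀ i, 0 < ‖c i‖ := fun i => by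
    refine norm_pos_iff.2 fun h => ?_
    obtain ⟨a, b, hab⟩ := hne i
    have h' : ∀ a, G.payoff a i - avg i = 0 := fun a =>
      congrArg (fun x : EuclideanSpace ℝ A => x a) h
    exact hab (by linarith [h' a, h' b])
  -- Centring and normalizing removes exactly the positive affine freedom, so nonequivalent players
  -- have distinct unit vectors.
  let u : Fin n → EuclideanSpace ℝ A := fun i => ‖c i‖⁻¹ • c i
  have hu : ∀ i, ‖u i‖ = 1 := fun i => norm_smul_inv_norm (𝕜 := ℝ) (norm_pos_iff.1 (hc i))
  have hcu : ∀ i, c i = ‖c i‖ • u i := fun i => (smul_inv_smul₀ (hc i).ne' _).symm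
  have hune : ∀ i j, i ≠ j → u j ≠ u i := by
    intro i j hij h
    refine hG ⟨i, j, hij, avg i - ‖c i‖ / ‖c j‖ * avg j, ‖c i‖ / ‖c j‖, div_pos (hc i) (hc j),
      fun a => ?_⟩
    have h1 : ‖c j‖⁻¹ * (G.payoff a j - avg j) = ‖c i‖⁻¹ * (G.payoff a i - avg i) :=
      congrArg (fun x : EuclideanSpace ℝ A => x a) h
    have hi := (hc i).ne'
    have hj := (hc j).ne'
    field_simp at h1 ⊢
    linarith
  have husum : ∀ i, ∑ a, u i a = 0 := fun i => by
    simp only [u, PiLp.smul_apply, smul_eq_mul, ← mul_sum, hcsum, mul_zero]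
  have huabs : ∀ i a, u i a ≤ 1 := fun i a =>
    (le_abs_self _).trans ((PiLp.norm_apply_le (u i) a).trans (hu i).le)
  have hpay : ∀ i j, G.expectedPayoff (fun a => m⁻¹ - m⁻¹ * u j a) i
      = avg i - m⁻¹ * (‖c i‖ * inner ℝ (u j) (u i)) := by
    intro i j
    have h1 : ∑ a, u j a * G.payoff a i = ‖c i‖ * inner ℝ (u j) (u i) := by
      rw [← inner_smul_right, ← hcu]
      have : ∀ a, u j a * G.payoff a i = u j a * c i a + u j a * avg i := fun a => by
        simp only [c]; ring
      simp only [this, sum_add_distrib, ← sum_mul, husum, zero_mul, add_zero, PiLp.inner_apply]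
      exact sum_congr rfl fun a _ => by simp [mul_comm]
    rw [← h1]
    simp only [expectedPayoff, sub_mul, sum_sub_distrib, mul_assoc, ← mul_sum, avg]
    ring
  -- The uniform lottery is tilted against `u j`. Player `i` loses in proportion to the inner
  -- product of `u j` and `u i`, which by strict Cauchy–Schwarz is largest only at `j = i`.
  refine ⟨fun j a => m⁻¹ - m⁻¹ * u j a, fun j => ⟨fun a => ?_, ?_⟩, fun i j hij => ?_⟩
  · have := mul_le_mul_of_nonneg_left (huabs j a) (inv_pos.2 hm0).le
    linarith
  · rw [sum_sub_distrib, ← mul_sum, husum]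
    simp [← hm, hm0.ne']
  · rw [hpay, hpay]
    have h1 : inner ℝ (u j) (u i) < 1 :=
      (inner_lt_one_iff_real_of_norm_eq_one (hu j) (hu i)).2 (hune i j hij)
    have h2 : inner ℝ (u i) (u i) = (1 : ℝ) := by rw [real_inner_self_eq_norm_sq, hu, one_pow]
    rw [h2]
    have := mul_lt_mul_of_pos_left (mul_lt_mul_of_pos_left h1 (hc i)) (inv_pos.2 hm0)
    linarith

/-- Player-specific punishments. -/
theorem exists_punishment_lotteries [Nonempty A] (G : StageGame n A) (hG : G.NEU) {w : A → ℝ}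
    (hw : w ∈ stdSimplex ℝ A) (hir : ∀ i, G.minmax i < G.expectedPayoff w i) :
    ∃ r : Fin n → A → ℝ, (∀ i, r i ∈ stdSimplex ℝ A) ∧
      (∀ i, G.minmax i < G.expectedPayoff (r i) i) ∧
      (∀ i, G.expectedPayoff (r i) i < G.expectedPayoff w i) ∧
      ∀ i j, i ≠ j → G.expectedPayoff (r i) i < G.expectedPayoff (r j) i := by
  classical
  have hworst : ∀ i, ∃ a, (∀ b, G.payoff a i ≤ G.payoff b i) ∧
      G.payoff a i < G.expectedPayoff w i := by
    intro i
    obtain ⟨a, ha⟩ := Finite.exists_min fun a => G.payoff a i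
    obtain ⟨b, hb⟩ := G.exists_minmax_recommendation i
    exact ⟨a, ha, ((ha b).trans (hb b (G.eff_refl _ (singleton_nonempty i) b))).trans_lt (hir i)⟩
  choose z hz hzw using hworst
  obtain ⟨s, hs, hsep⟩ := G.exists_separating_lotteries hG fun i => by
    by_contra! h
    exact (hzw i).not_ge (G.expectedPayoff_le hw fun a => (h a (z i)).le)
  have hlin : ∀ p q : ℝ, Tendsto (fun c : ℝ => (1 - c) * p + c * q) (𝓝[>] 0) (𝓝 p) := by
    intro p q
    have : Continuous fun c : ℝ => (1 - c) * p + c * q := by fun_prop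
    simpa using (this.tendsto 0).mono_left nhdsWithin_le_nhds
  have hunit : ∀ᶠ c : ℝ in 𝓝[>] 0, 0 < c ∧ c < 1 := Ioo_mem_nhdsGT one_pos
  have hmix : ∀ {p q : A → ℝ} {c : ℝ}, p ∈ stdSimplex ℝ A → q ∈ stdSimplex ℝ A → 0 < c ∧ c < 1 →
      (1 - c) • p + c • q ∈ stdSimplex ℝ A := fun hp hq hc =>
    convex_stdSimplex ℝ A hp hq (sub_nonneg.2 hc.2.le) hc.1.le (sub_add_cancel _ _)
  obtain ⟨c, hc, hcw⟩ := (hunit.and (eventually_all.2 fun i =>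
    (hlin (G.payoff (z i) i) (G.expectedPayoff (s i) i)).eventually_lt_const (hzw i))).exists
  -- The worst alternative `z i` separates weakly and `s i` makes the separation strict. A small `c`
  -- keeps `y i` worse than `w` for `i`, and the small weight `e` on `y i` below keeps the mixture
  -- above the minmax.
  let y : Fin n → A → ℝ := fun i => (1 - c) • Pi.single (z i) 1 + c • s i
  have hy : ∀ i, y i ∈ stdSimplex ℝ A := fun i => hmix (single_mem_stdSimplex ℝ _) (hs i) hc
  have hpay : ∀ i j, G.expectedPayoff (y j) i
      = (1 - c) * G.payoff (z j) i + c * G.expectedPayoff (s j) i := fun i j => by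
    simp only [y, expectedPayoff_convexCombination, expectedPayoff_single]
  obtain ⟨e, he, hew⟩ := (hunit.and (eventually_all.2 fun i =>
    (hlin (G.expectedPayoff w i) (G.expectedPayoff (y i) i)).eventually_const_lt (hir i))).exists
  refine ⟨fun i => (1 - e) • w + e • y i, fun i => hmix hw (hy i) he, fun i => ?_, fun i => ?_,
    fun i j hij => ?_⟩
  · rw [expectedPayoff_convexCombination]
    exact hew i
  · rw [expectedPayoff_convexCombination]
    have := mul_lt_mul_of_pos_left ((hpay i i).trans_lt (hcw i)) he.1
    linarith
  · rw [G.expectedPayoff_convexCombination w (y i), G.expectedPayoff_convexCombination w (y j)]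
    refine add_lt_add_right (mul_lt_mul_of_pos_left ?_ he.1) _
    rw [hpay, hpay]
    exact add_lt_add_of_le_of_lt (mul_le_mul_of_nonneg_left (hz i _) (sub_nonneg.2 hc.2.le))
      (mul_lt_mul_of_pos_left (hsep i j hij) hc.1)

end Lottery

/-! ### Values of paths that begin with a punishment phase. -/

/-- Values along a path that starts with `T` periods with payoff `b` and continues with a path
with values `X`. -/
def delayedValue (δ b : ℝ) (T : ℕ) (X : ℕ → ℝ) (t : ℕ) : ℝ :=
  if t < T then (1 - δ ^ (T - t)) * b + δ ^ (T - t) * X 0 else X (t - T)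

theorem delayedValue_recursion {δ b : ℝ} {T : ℕ} {X f : ℕ → ℝ}
    (hX : ∀ t, X t = (1 - δ) * f t + δ * X (t + 1)) (t : ℕ) :
    delayedValue δ b T X t =
      (1 - δ) * (if t < T then b else f (t - T)) + δ * delayedValue δ b T X (t + 1) := by
  unfold delayedValue
  rcases lt_trichotomy (t + 1) T with h | h | h
  · obtain ⟨s, rfl⟩ := Nat.exists_eq_add_of_lt h
    have h1 : t + 1 + s + 1 - t = s + 1 + 1 := by omega
    have h2 : t + 1 + s + 1 - (t + 1) = s + 1 := by omega
    rw [if_pos (by omega), if_pos (by omega), if_pos h, h1, h2, pow_succ]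
    ring
  · subst h
    simp
  · rw [if_neg (by omega), if_neg (by omega), if_neg (by omega), hX,
      show t + 1 - T = t - T + 1 by omega]

theorem one_sub_pow_le {δ : ℝ} (h0 : 0 ≤ δ) (T : ℕ) : 1 - δ ^ T ≤ T * (1 - δ) := by
  have := one_add_mul_le_pow (a := δ - 1) (by linarith) T
  rw [add_sub_cancel] at this
  linarith

/-- The right side is `1 - δ` times a sum of `T` powers of `δ`, each at least `δ ^ T`. This shows
that the harm done by a punishment is of order `T * (1 - δ)`. -/
theorem mul_pow_le_one_sub_pow {δ : ℝ} (h0 : 0 ≤ δ) (h1 : δ ≤ 1) (T : ℕ) :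
    T * (1 - δ) * δ ^ T ≤ 1 - δ ^ T := by
  have h : ∀ s ∈ range T, δ ^ T ≤ δ ^ s := fun s hs =>
    pow_le_pow_of_le_one h0 h1 (mem_range.1 hs).le
  have h2 := mul_le_mul_of_nonneg_right (sum_le_sum h) (sub_nonneg.2 h1)
  rw [geom_sum_mul_neg] at h2
  simp only [sum_const, card_range, nsmul_eq_mul] at h2
  linarith

/-- At most `T` periods of the initial phase remain, and each costs at most `2 * M * (1 - δ)`. -/
theorem le_delayedValue {δ b K M : ℝ} {T : ℕ} {X : ℕ → ℝ} (h0 : 0 ≤ δ) (h1 : δ ≤ 1)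
    (hb : -M ≤ b) (hXM : X 0 ≤ M) (hM : 0 ≤ M) (hK : 0 ≤ K)
    (hX : ∀ t, X 0 - K * (1 - δ) ≤ X t) (t : ℕ) :
    X 0 - (K + 2 * M * T) * (1 - δ) ≤ delayedValue δ b T X t := by
  have hT : (0 : ℝ) ≤ T := Nat.cast_nonneg T
  have hd := sub_nonneg.2 h1
  unfold delayedValue
  split_ifs with h
  · have h2 : 1 - δ ^ (T - t) ≤ T * (1 - δ) := (one_sub_pow_le h0 _).trans
      (mul_le_mul_of_nonneg_right (Nat.cast_le.2 (Nat.sub_le T t)) hd)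
    have h3 : 0 ≤ 1 - δ ^ (T - t) := sub_nonneg.2 (pow_le_one₀ h0 h1)
    have h4 : (1 - δ ^ (T - t)) * (X 0 - b) ≤ (1 - δ ^ (T - t)) * (2 * M) :=
      mul_le_mul_of_nonneg_left (by linarith) h3
    have h5 := mul_le_mul_of_nonneg_right h2 (by linarith : 0 ≤ 2 * M)
    have h6 := mul_nonneg hK hd
    linarith
  · have : 0 ≤ 2 * M * T * (1 - δ) := by positivity
    linarith [hX (t - T)]

theorem delayedValue_le {δ b B : ℝ} {T : ℕ} {X : ℕ → ℝ} (h0 : 0 ≤ δ) (h1 : δ ≤ 1)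
    (hb : b ≤ B) (hX : ∀ t, X t ≤ B) (t : ℕ) : delayedValue δ b T X t ≤ B := by
  unfold delayedValue
  split_ifs with h
  · have h2 : 0 ≤ δ ^ (T - t) := by positivity
    have h3 : 0 ≤ 1 - δ ^ (T - t) := sub_nonneg.2 (pow_le_one₀ h0 h1)
    linarith [mul_le_mul_of_nonneg_left hb h3, mul_le_mul_of_nonneg_left (hX 0) h2]
  · exact hX _

/-- Choice of the scapegoat when `k` is the player being punished, if any. -/
theorem exists_mem_ne_or_eq_singleton {ι : Type*} (k : Option ι) {C : Finset ι} (hC : C.Nonempty) :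
    ∃ j ∈ C, k ≠ some j ∨ k = some j ∧ C = {j} := by
  by_cases h : ∃ j ∈ C, k ≠ some j
  · obtain ⟨j, hj, hk⟩ := h
    exact ⟨j, hj, .inl hk⟩
  · push Not at h
    obtain ⟨j, hj⟩ := hC
    refine ⟨j, hj, .inr ⟨h j hj, eq_singleton_iff_unique_mem.2 ⟨hj, fun x hx => ?_⟩⟩⟩
    exact Option.some_injective _ ((h x hx).symm.trans (h j hj))

end StageGame
-- The stable convention and its incentive constraints.
namespace StageGame

variable {n : ℕ} {A : Type*} [Fintype A] [Nonempty A]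

/-- A family of target payoffs `U`, one on the path of play and one for every player, is supported
by a stable convention for a given `δ`, if the paths that implement the targets and the
length `T` of the punishments satisfy the incentive constraints. Deviations by a coalition are
punished by minmaxing one of its members for `T` periods, if possible a member that is not being
punished already. -/
theorem exists_isStableConvention_of_punishments (G : StageGame n A) {δ M K g : ℝ} {T : ℕ}
    (hM0 : 0 ≤ M) (hM : ∀ a i, |G.payoff a i| ≤ M) (hK : 0 ≤ K) (hg : 0 < g)
    (hT : 2 * M + K ≤ T * g / 4) (hδ : 1 / 2 ≤ δ) (hδ1 : δ < 1) (hδT : 1 / 2 ≤ δ ^ T)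
    (hδg : (2 * M + (K + 2 * M * T)) * (1 - δ) ≤ g)
    (q : Option (Fin n) → ℕ → A) (X : Option (Fin n) → ℕ → Fin n → ℝ)
    (hXM : ∀ k i, |X k 0 i| ≤ M)
    (hrec : ∀ k t i, X k t i = (1 - δ) * G.payoff (q k t) i + δ * X k (t + 1) i)
    (hXK : ∀ k t i, |X k t i - X k 0 i| ≤ K * (1 - δ))
    (hmm : ∀ i, G.minmax i + g ≤ X (some i) 0 i)
    (hsep : ∀ k i, k ≠ some i → X (some i) 0 i + g ≤ X k 0 i) :
    ∃ σ : Plan n A, G.IsStableConvention δ σ ∧ ∀ i, G.value δ σ [] i = X none 0 i := by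
  have hδ0 : 0 ≤ δ := by linarith
  have hd : 0 < 1 - δ := sub_pos.2 hδ1
  choose m hm using G.exists_minmax_recommendation
  choose tgt htgtC htgt using fun (k : Option (Fin n)) (C : {C : Finset (Fin n) // C.Nonempty}) =>
    exists_mem_ne_or_eq_singleton k C.2
  -- A state is a regime together with its clock. The target regime `none` has no minmax phase, so
  -- its `pun` is a dummy value.
  let len : Option (Fin n) → ℕ := fun k => k.elim 0 fun _ => T
  let pun : Option (Fin n) → A := fun k => k.elim (Classical.arbitrary A) m
  let play : Option (Fin n) × ℕ → A := fun s =>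
    if s.2 < len s.1 then pun s.1 else q s.1 (s.2 - len s.1)
  let next : Option (Fin n) × ℕ → Outcome n A → Option (Fin n) × ℕ := fun s o =>
    if h : o.2.Nonempty then (some (tgt s.1 ⟨o.2, h⟩), 0) else (s.1, s.2 + 1)
  let W : Option (Fin n) × ℕ → Fin n → ℝ := fun s i =>
    delayedValue δ (G.payoff (pun s.1) i) (len s.1) (fun t => X s.1 t i) s.2
  have hlenT : ∀ k, (len k : ℝ) ≤ T := by
    rintro (_ | i) <;> simp [len]
  have hlow : ∀ s i, X s.1 0 i - (K + 2 * M * T) * (1 - δ) ≤ W s i := by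
    intro s i
    refine le_trans ?_ (le_delayedValue (M := M) (K := K) hδ0 hδ1.le (neg_le_of_abs_le (hM _ i))
      (le_of_abs_le (hXM s.1 i)) hM0 hK (fun t => ?_) s.2)
    · have h1 := mul_le_mul_of_nonneg_left (hlenT s.1) (by linarith : 0 ≤ 2 * M)
      have h2 := mul_le_mul_of_nonneg_right h1 hd.le
      linarith
    · linarith [neg_le_of_abs_le (hXK s.1 t i)]
  have hpos : 0 ≤ 2 * M * T := by positivity
  have hinit : ∀ i, W (some i, 0) i ≤ X (some i) 0 i - (1 - δ ^ T) * g := by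
    intro i
    have hb : G.payoff (m i) i ≤ G.minmax i :=
      hm i _ (G.eff_refl _ (singleton_nonempty i) _)
    have h3 : 0 ≤ 1 - δ ^ T := sub_nonneg.2 (pow_le_one₀ hδ0 hδ1.le)
    have h4 := mul_le_mul_of_nonneg_left
      (by linarith [hmm i] : G.payoff (m i) i ≤ X (some i) 0 i - g) h3
    change delayedValue δ (G.payoff (m i) i) T (fun t => X (some i) t i) 0 ≤ _
    unfold delayedValue
    split_ifs with h
    · rw [Nat.sub_zero]
      linarith
    · obtain rfl : T = 0 := by omega
      simp
  have hcont : ∀ a i, (1 - δ) * G.payoff a i ≤ (1 - δ) * M := fun a i =>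
    mul_le_mul_of_nonneg_left (le_of_abs_le (hM a i)) hd.le
  have hshrink : ∀ k i, δ * X k 0 i ≤ X k 0 i + (1 - δ) * M := fun k i => by
    linarith [mul_le_mul_of_nonneg_left (neg_le_of_abs_le (hXM k i)) hd.le]
  refine G.exists_isStableConvention_of_automaton (B := M + (K + 2 * M * T)) hδ0 hδ1 (none, 0)
    play next W (fun a i => by linarith [hM a i]) ?_ ?_ ?_
  · intro s i
    refine abs_le.2 ⟨?_, delayedValue_le hδ0 hδ1.le ?_ (fun t => ?_) _⟩
    · have := mul_le_mul_of_nonneg_left (by linarith : 1 - δ ≤ 1)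
        (by positivity : 0 ≤ K + 2 * M * T)
      linarith [hlow s i, neg_le_of_abs_le (hXM s.1 i)]
    · linarith [le_of_abs_le (hM (pun s.1) i)]
    · have := mul_le_mul_of_nonneg_left (by linarith : 1 - δ ≤ 1) hK
      linarith [le_of_abs_le (hXK s.1 t i), le_of_abs_le (hXM s.1 i)]
  · intro s i
    have hn : next s (play s, ∅) = (s.1, s.2 + 1) := by simp [next]
    rw [hn]
    refine (delayedValue_recursion (fun t => hrec s.1 t i) s.2).trans ?_
    congr 2
    simp only [play]
    split_ifs <;> rfl
  · rintro ⟨k, t⟩ C hC a' ha'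
    have hn : next (k, t) (a', C) = (some (tgt k ⟨C, hC⟩), 0) := dif_pos hC
    rw [hn]
    refine ⟨tgt k ⟨C, hC⟩, htgtC k ⟨C, hC⟩, ?_⟩
    have hcase := htgt k ⟨C, hC⟩
    generalize tgt k ⟨C, hC⟩ = j at hcase
    have hWj := hinit j
    have hT0 : 0 ≤ 1 - δ ^ T := sub_nonneg.2 (pow_le_one₀ hδ0 hδ1.le)
    rcases hcase with hk | ⟨rfl, hCj⟩
    -- A scapegoat not yet being punished loses about `g` in continuation value, against a gain of
    -- order `1 - δ`.
    · have h1 : W (some j, 0) j ≤ X (some j) 0 j := by linarith [mul_nonneg hT0 hg.le]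
      have h2 := mul_le_mul_of_nonneg_left h1 hδ0
      linarith [hlow (k, t) j, hsep k j hk, hshrink (some j) j, hcont a' j]
    -- The punished player deviates alone. During her minmax phase she gets at most her minmax now
    -- and restarts the phase, while her value exceeds the minmax and rises as the phase runs down.
    · by_cases ht : t < T
      · have ha : a' ∈ G.eff {j} (m j) := by
          have : play (some j, t) = m j := if_pos ht
          rwa [this, show C = {j} from hCj] at ha'
        have h1 := mul_le_mul_of_nonneg_left (hm j a' ha) hd.le
        have h2 : G.minmax j ≤ W (some j, 0) j := by
          have := hlow (some j, 0) j
          have h3 : 0 ≤ 2 * M * (1 - δ) := by positivity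
          simp only at this
          linarith [hmm j]
        have h3 : W (some j, 0) j ≤ W (some j, t) j := by
          change delayedValue δ (G.payoff (m j) j) T (fun t => X (some j) t j) 0 ≤
            delayedValue δ (G.payoff (m j) j) T (fun t => X (some j) t j) t
          unfold delayedValue
          rw [if_pos ht, if_pos (by omega)]
          have hb : G.payoff (m j) j ≤ X (some j) 0 j := by
            linarith [hmm j, hm j _ (G.eff_refl _ (singleton_nonempty j) _)]
          have hp : δ ^ (T - 0) ≤ δ ^ (T - t) :=
            pow_le_pow_of_le_one hδ0 hδ1.le (by omega)
          linarith [mul_le_mul_of_nonneg_right hp (sub_nonneg.2 hb)]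
        linarith [mul_le_mul_of_nonneg_left h2 hd.le]
      -- After the phase she gains at most `(2 * M + K) * (1 - δ)`, and a new phase costs her at
      -- least `T * (1 - δ) * g / 4`. The two halves in the 4 come from `δ ^ T` and `δ`.
      · have h1 : W (some j, t) j = X (some j) (t - T) j := if_neg ht
        have h2 : T * (1 - δ) * (1 / 2) ≤ 1 - δ ^ T :=
          (mul_le_mul_of_nonneg_left hδT (by positivity)).trans
            (mul_pow_le_one_sub_pow hδ0 hδ1.le T)
        have h3 := mul_le_mul_of_nonneg_right h2 hg.le
        have h4 : δ * W (some j, 0) j ≤ δ * (X (some j) 0 j - T * (1 - δ) * (1 / 2) * g) :=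
          mul_le_mul_of_nonneg_left (by linarith) hδ0
        have h5 : 1 / 2 * (T * (1 - δ) * (1 / 2) * g) ≤ δ * (T * (1 - δ) * (1 / 2) * g) :=
          mul_le_mul_of_nonneg_right hδ (by positivity)
        have h6 := mul_le_mul_of_nonneg_right hT hd.le
        rw [h1]
        linarith [hcont a' j, hshrink (some j) j, neg_le_of_abs_le (hXK (some j) (t - T) j)]

theorem eventually_exists_isStableConvention (G : StageGame n A) (hG : G.NEU) {v : Fin n → ℝ}
    (hv : v ∈ G.feasibleIR) : ∀ᶠ δ in 𝓝[<] (1 : ℝ),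
      ∃ σ : Plan n A, G.IsStableConvention δ σ ∧ ∀ i, G.value δ σ [] i = v i := by
  obtain ⟨w, hw, rfl⟩ := G.exists_lottery_of_mem_feasible hv.1
  obtain ⟨r, hr, hrmm, hrw, hrr⟩ := G.exists_punishment_lotteries hG hw hv.2
  obtain ⟨M, hM0, hM⟩ := G.exists_abs_payoff_le
  let l : Option (Fin n) → A → ℝ := fun k => k.elim w r
  have hl : ∀ k, l k ∈ stdSimplex ℝ A := by
    rintro (_ | i)
    exacts [hw, hr i]
  have hlsep : ∀ k i, k ≠ some i →
      G.expectedPayoff (l (some i)) i < G.expectedPayoff (l k) i := by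
    rintro (_ | j) i hk
    exacts [hrw i, hrr i j fun h => hk (h ▸ rfl)]
  choose K hK0 hK using fun k => G.exists_path_of_lottery (hl k)
  have hKle : ∀ k, K k ≤ ∑ k, K k := fun k => single_le_sum (fun k _ => hK0 k) (mem_univ k)
  obtain ⟨g, hg, hgmm, hgsep⟩ : ∃ g : ℝ, 0 < g ∧
      (∀ i, G.minmax i + g ≤ G.expectedPayoff (l (some i)) i) ∧
      ∀ k i, k ≠ some i →
        G.expectedPayoff (l (some i)) i + g ≤ G.expectedPayoff (l k) i := by
    have hgap : ∀ {x y : ℝ}, x < y → ∀ᶠ g in 𝓝[>] (0 : ℝ), x + g ≤ y := fun {x y} hxy => by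
      filter_upwards [Ioo_mem_nhdsGT (sub_pos.2 hxy)] with g hg
      linarith [hg.2]
    have hpos : ∀ᶠ g in 𝓝[>] (0 : ℝ), 0 < g := self_mem_nhdsWithin
    refine (hpos.and ((eventually_all.2 fun i => hgap (hrmm i)).and
      (eventually_all.2 fun k => eventually_all.2 fun i => ?_))).exists
    by_cases hk : k = some i
    · exact Eventually.of_forall fun _ h => absurd hk h
    · exact (hgap (hlsep k i hk)).mono fun _ h _ => h
  -- The sum of the `K k` serves as one error constant for all regimes.
  obtain ⟨T, hT⟩ := exists_nat_ge ((2 * M + ∑ k, K k) * 4 / g)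
  have hhalf : ∀ᶠ δ in 𝓝[<] (1 : ℝ), 1 / 2 < δ :=
    eventually_nhdsWithin_of_eventually_nhds (eventually_gt_nhds (by norm_num))
  have hpow : ∀ᶠ δ in 𝓝[<] (1 : ℝ), 1 / 2 < δ ^ T := by
    refine eventually_nhdsWithin_of_eventually_nhds
      (((continuous_pow T).tendsto 1).eventually_const_lt ?_)
    norm_num
  have hsmall : ∀ᶠ δ in 𝓝[<] (1 : ℝ),
      (2 * M + (∑ k, K k + 2 * M * T)) * (1 - δ) < g := by
    have hc : Continuous fun δ : ℝ => (2 * M + (∑ k, K k + 2 * M * T)) * (1 - δ) := by fun_prop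
    refine eventually_nhdsWithin_of_eventually_nhds ((hc.tendsto 1).eventually_lt_const ?_)
    simpa using hg
  filter_upwards [hhalf, hpow, hsmall, eventually_all.2 hK, self_mem_nhdsWithin]
    with δ hδ hδT hδg hpath hδ1
  have hδ1 : δ < 1 := hδ1
  choose q X hX0 hrec hXK using hpath
  rw [show G.expectedPayoff w = X none 0 from (hX0 none).symm]
  simp only [← hX0] at hXK hgmm hgsep
  refine G.exists_isStableConvention_of_punishments hM0 hM (sum_nonneg fun k _ => hK0 k) hg ?_
    hδ.le hδ1 hδT.le hδg.le q X (fun k i => ?_) hrec (fun k t i => ?_) hgmm hgsep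
  · rw [div_le_iff₀ hg] at hT
    linarith
  · rw [hX0]
    exact abs_le.2 ⟨G.le_expectedPayoff (hl k) fun a => neg_le_of_abs_le (hM a i),
      G.expectedPayoff_le (hl k) fun a => le_of_abs_le (hM a i)⟩
  · exact (hXK k t i).trans (mul_le_mul_of_nonneg_right (hKle k) (sub_pos.2 hδ1).le)

end StageGame

theorem theorem1 {n : ℕ} {A : Type*} [Fintype A] [Nonempty A] (G : StageGame n A) :
    (∀ δ : ℝ, 0 ≤ δ → δ < 1 → ∀ σ : Plan n A, G.IsStableConvention δ σ →
      ∀ i : Fin n, G.minmax i ≤ G.value δ σ [] i) ∧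
    (G.NEU → ∀ v ∈ G.feasibleIR, ∃ δ₀ : ℝ, 0 ≤ δ₀ ∧ δ₀ < 1 ∧
      ∀ δ : ℝ, δ₀ < δ → δ < 1 → ∃ σ : Plan n A, G.IsStableConvention δ σ ∧
        ∀ i : Fin n, G.value δ σ [] i = v i) := by
  refine ⟨fun δ h0 h1 σ hσ i => G.minmax_le_value_of_isStableConvention h0 h1 hσ [] i,
    fun hG v hv => ?_⟩
  obtain ⟨δ₀, ⟨h0, h1⟩, h⟩ := (mem_nhdsLT_iff_exists_mem_Ico_Ioo_subset zero_lt_one).1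
    (G.eventually_exists_isStableConvention hG hv)
  exact ⟨δ₀, h0, h1, fun δ h2 h3 => h ⟨h2, h3⟩⟩
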